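/- Fix an integer $k\ge 3$ and a real $\beta>\frac{2k-1}{k-1}$. For $n\ge k$ and $m\ge 0$, a random power-law $k$-SAT formula $\Phi$ with $n$ variables, $m$ clauses and exponent $\beta$ is obtained as follows. Variable $i\in\{1,\dots,n\}$ has weight $w_i=i^{-1/(\beta-1)}$. The $m$ clauses are sampled independently. For each clause, $k$ distinct variables are drawn one after the other, each time with probabilities proportional to the weights of the variables not yet drawn in this clause, and then each of the $k$ variables is negated independently with probability $1/2$. The resolution width of an unsatisfiable formula is the minimum, over all its resolution refutations, of the size of the largest clause appearing in the refutation. Let $m=m(n)$ be a sequence with $m\in\Omega(n)$, i.e. $m(n)\ge\delta n$ for some constant $\delta>0$ and all large $n$, put $\Delta=\Delta(n)=m/n$, and suppose that there is a constant $p>0$ such that $\Pr[\Phi\text{ is unsatisfiable}]\ge p$ for all large $n$. Let $\varepsilon>0$ be a constant such that $$\varepsilon_1=\tfrac{k-\varepsilon}{2}-1>0\quad\text{and}\quad \varepsilon_2=(k-\varepsilon)\tfrac{\beta-2}{\beta-1}-1>0 .$$ Then, conditioned on $\Phi$ being unsatisfiable, the resolution width $w$ of $\Phi$ satisfies each of the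 following with probability tending to $1$ as $n\to\infty$. (i) If $\beta\in\left(\frac{2k-1}{k-1},3\right)$ and $\Delta\in o(n^{\varepsilon_2})$, then $w\in\Omega\left(n^{\varepsilon_2/\varepsilon_1}\,\Delta^{-1/\varepsilon_1}\right)$. (ii) If $\beta=3$ and $\Delta\in o\left(n^{\varepsilon_1}/\log^{1+\varepsilon_1}n\right)$, then $w\in\Omega\left(n\,\Delta^{-1/\varepsilon_1}/\log^{1+1/\varepsilon_1}n\right)$. (iii) If $\beta>3$ and $\Delta\in o(n^{\varepsilon_1})$, then $w\in\Omega\left(n\,\Delta^{-1/\varepsilon_1}\right)$. (iv) If $\beta>\frac{2k-2}{k-2}$, $\varepsilon_3$ is a constant with $0<\varepsilon_3<\frac{k}{2}\cdot\frac{\beta-2}{\beta-1}-1$, and $\Delta\in o\left(n^{\varepsilon_3}/\log^{\varepsilon_3}n\right)$, then $w\in\Omega\left(n\,\Delta^{-1/\varepsilon_3}\right)$. Here the constants hidden in $\Omega$ depend only on $k,\beta,\varepsilon,\varepsilon_3$ and $\delta$. -/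

import Mathlib

namespace PowerLawSAT

/-! ### CNF formulas and resolution -/

/-- A literal over the variables `Fin n`: `(x, true)` is `x` and `(x, false)` is `¬ x`. -/
abbrev Literal (n : ℕ) := Fin n × Bool

/-- A clause is a finite set of literals (their disjunction). -/
abbrev Clause (n : ℕ) := Finset (Literal n)

/-- A formula in conjunctive normal form is a finite set of clauses (their conjunction). -/
abbrev CNF (n : ℕ) := Finset (Clause n)

/-- Some truth assignment `τ` makes at least one literal of every clause true. -/
def Satisfiable {n : ℕ} (F : CNF n) : Prop :=
  ∃ τ : Fin n → Bool, ∀ C ∈ F, ∃ l ∈ C, τ l.1 = l.2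

/-- `Derivation F C` is the type of resolution proofs of the clause `C` from the clauses of `F`. -/
inductive Derivation {n : ℕ} (F : CNF n) : Clause n → Type
  | ax {C : Clause n} (h : C ∈ F) : Derivation F C
  | resolve {C D : Clause n} (x : Fin n) (hC : (x, true) ∈ C) (hD : (x, false) ∈ D)
      (d : Derivation F C) (e : Derivation F D) :
      Derivation F (C.erase (x, true) ∪ D.erase (x, false))

/-- The width of a resolution proof: the size of the largest clause appearing in it. -/
def Derivation.width {n : ℕ} {F : CNF n} : {C : Clause n} → Derivation F C → ℕ
  | C, .ax _ => C.card
  | _, .resolve (C := C) (D := D) x _ _ d e =>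
      max (C.erase (x, true) ∪ D.erase (x, false)).card (max d.width e.width)

/-- The resolution width of `F`: the least width of a resolution refutation of `F`, i.e. of a
resolution proof of the empty clause (`⊤` if there is no refutation). -/
noncomputable def resolutionWidth {n : ℕ} (F : CNF n) : ℕ∞ :=
  ⨅ d : Derivation F (∅ : Clause n), (d.width : ℕ∞)

/-! ### The power-law random `k`-SAT model -/

/-- One sampled clause: the `k` distinct variables in the order in which they are drawn, and the
sign of each of them. -/
abbrev Draw (k n : ℕ) := (Fin k ↪ Fin n) × (Fin k → Bool)

/-- The sampled formulas with `m` clauses of size `k` over `n` variables. -/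
abbrev Sample (k n m : ℕ) := Fin m → Draw k n

/-- The CNF formula consisting of the sampled clauses. -/
def Sample.toCNF {k n m : ℕ} (Φ : Sample k n m) : CNF n :=
  Finset.univ.image fun j : Fin m =>
    Finset.univ.image fun t : Fin k => (((Φ j).1 t, (Φ j).2 t) : Literal n)

/-- The discrete power-law weights `w_i = i ^ (-1 / (β - 1))`, `i = 1, …, n`
(the element `i : Fin n` stands for the variable with number `i + 1`). -/
noncomputable def weight (β : ℝ) {n : ℕ} (i : Fin n) : ℝ :=
  ((i : ℕ) + 1 : ℝ) ^ (-1 / (β - 1))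

/-- The probability of drawing the variables `v 0, v 1, …, v (k - 1)` in this order, when the
variables are drawn one after the other without repetition, each time with probabilities
proportional to the weights of the variables that have not been drawn yet. -/
noncomputable def varsMass (β : ℝ) {k n : ℕ} (v : Fin k ↪ Fin n) : ℝ :=
  ∏ t : Fin k, weight β (v t) / ∑ i : Fin n with ∀ s < t, v s ≠ i, weight β i

/-- The probability of a sampled clause: each variable is negated independently with
probability `1 / 2`. -/
noncomputable def drawMass (β : ℝ) {k n : ℕ} (c : Draw k n) : ℝ :=
  varsMass β c.1 * (1 / 2) ^ k

/-- The probability of a sampled formula: the `m` clauses are sampled independently. -/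
noncomputable def sampleMass (β : ℝ) {k n m : ℕ} (Φ : Sample k n m) : ℝ :=
  ∏ j : Fin m, drawMass β (Φ j)

open scoped Classical in
/-- The probability of an event in the power-law model with exponent `β`
(a probability measure whenever `k ≤ n`). -/
noncomputable def prob (β : ℝ) {k n m : ℕ} (A : Set (Sample k n m)) : ℝ :=
  ∑ Φ : Sample k n m with Φ ∈ A, sampleMass β Φ

/-- The conditional probability of `A` given `B`. -/
noncomputable def condProb (β : ℝ) {k n m : ℕ} (A B : Set (Sample k n m)) : ℝ :=
  prob β (A ∩ B) / prob β B

/-- The event that the formula is unsatisfiable. -/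
def unsat (k n m : ℕ) : Set (Sample k n m) := {Φ | ¬ Satisfiable Φ.toCNF}

/-- The event that the resolution width of the formula is at least the real number `x`. -/
def widthAtLeast (k n m : ℕ) (x : ℝ) : Set (Sample k n m) :=
  {Φ | (⌈x⌉₊ : ℕ∞) ≤ resolutionWidth Φ.toCNF}

end PowerLawSAT

open Filter Topology Asymptotics PowerLawSAT

/-! Width is bounded below by boundary expansion, following Ben-Sasson and Wigderson. If every
nonempty set of at most `r` clauses has at least `b` times as many boundary variables as clauses,
every refutation has width at least `b * r / 2` (`ceil_le_resolutionWidth`).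

Expansion is proved by a first moment argument. For a fixed set of `i` clauses, the number of
variables at a unique position is controlled by Markov's inequality for `θ ^ U`. Its expectation is
an occupancy sum over all maps from positions to variables, hence a coefficient of a product of
exponential generating functions, one per variable (`sum_prod_fiberCard_le`). The `i` heaviest
variables are estimated crudely; for the others the discount `θ` nearly removes the linear term, so
only squared weights matter.

The sampling law is dominated by a product of power weights of exponent `a - 1`, where `a < 1/2`
makes the squared weights summable. A set of `i` clauses fails with probability at most `(C * (i /
n) ^ (a * (k - b))) ^ i` (`prob_fewUnique_le_pow`). The union bound over such sets then gives `(K *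
Δ * (i / n) ^ e) ^ i` with `e = a * (k - b) - 1`. Summed up to `r` of order `n * Δ ^ (-1 / e)`, this
tends to zero when `Δ = o(n ^ e)`.

All four regimes come from choosing `a` and `b` in `exists_widthBound`. Unsatisfiability enters only
through the conditioning, which costs a factor `1 / p`. -/

namespace PowerLawSAT

/-! ### Boundary expansion and resolution width -/

section Resolution

variable {n m : ℕ}

/-- The assignment `τ` makes some literal of `C` true. -/
def SatClause (τ : Fin n → Bool) (C : Clause n) : Prop := ∃ l ∈ C, τ l.1 = l.2

/-- Every assignment satisfying the clauses with index in `J` satisfies `C`. -/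
def Entails (cl : Fin m → Clause n) (J : Finset (Fin m)) (C : Clause n) : Prop :=
  ∀ τ : Fin n → Bool, (∀ j ∈ J, SatClause τ (cl j)) → SatClause τ C

open scoped Classical in
/-- The variables that occur in exactly one of the clauses with index in `J`. -/
noncomputable def boundary (cl : Fin m → Clause n) (J : Finset (Fin m)) : Finset (Fin n) :=
  {x | ∃! j, j ∈ J ∧ ∃ b, (x, b) ∈ cl j}

theorem satClause_update {τ : Fin n → Bool} {C : Clause n} {x : Fin n} (b : Bool)
    (hx : ∀ c, (x, c) ∉ C) : SatClause (Function.update τ x b) C ↔ SatClause τ C := by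
  refine exists_congr fun l => and_congr_right fun hl => ?_
  have : l.1 ≠ x := by
    rintro rfl
    exact hx l.2 hl
  rw [Function.update_of_ne this]

/-- Peeling: a boundary variable occurs in one clause only, so after satisfying the others by
induction it can be reset to satisfy that clause without harm. -/
theorem exists_satClause_of_boundary_nonempty (cl : Fin m → Clause n) (J : Finset (Fin m))
    (h : ∀ K ⊆ J, K.Nonempty → (boundary cl K).Nonempty) :
    ∃ τ, ∀ j ∈ J, SatClause τ (cl j) := by
  induction J using Finset.strongInduction with
  | H J ih =>
    rcases J.eq_empty_or_nonempty with rfl | hJ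
    · exact ⟨fun _ => true, by simp⟩
    obtain ⟨x, hx⟩ := h J subset_rfl hJ
    simp only [boundary, Finset.mem_filter, Finset.mem_univ, true_and] at hx
    obtain ⟨j, ⟨hj, b, hb⟩, hu⟩ := hx
    obtain ⟨τ, hτ⟩ := ih (J.erase j) (Finset.erase_ssubset hj)
      fun K hK => h K (hK.trans (Finset.erase_subset _ _))
    refine ⟨Function.update τ x b, fun i hi => ?_⟩
    by_cases hij : i = j
    · subst hij
      exact ⟨(x, b), hb, by simp⟩
    · exact (satClause_update b fun c hc => hij (hu i ⟨hi, c, hc⟩)).2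
        (hτ i (Finset.mem_erase.2 ⟨hij, hi⟩))

/-- A boundary variable absent from `C` could be reset to satisfy its only clause while changing
neither the other clauses nor `C`. That clause would then be redundant, against minimality. -/
theorem boundary_subset_of_minimal {cl : Fin m → Clause n} {J : Finset (Fin m)} {C : Clause n}
    (hJ : Entails cl J C) (hmin : ∀ j ∈ J, ¬ Entails cl (J.erase j) C) :
    boundary cl J ⊆ C.image Prod.fst := by
  intro x hx
  simp only [boundary, Finset.mem_filter, Finset.mem_univ, true_and] at hx
  obtain ⟨j, ⟨hj, b, hb⟩, hu⟩ := hx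
  by_contra hxC
  refine hmin j hj fun τ hτ => ?_
  have hxC' : ∀ c, (x, c) ∉ C := fun c hc => hxC (Finset.mem_image.2 ⟨_, hc, rfl⟩)
  rw [← satClause_update b hxC']
  refine hJ _ fun i hi => ?_
  by_cases hij : i = j
  · subst hij
    exact ⟨(x, b), hb, by simp⟩
  · exact (satClause_update b fun c hc => hij (hu i ⟨hi, c, hc⟩)).2
      (hτ i (Finset.mem_erase.2 ⟨hij, hi⟩))

theorem exists_minimal_entails {cl : Fin m → Clause n} {J : Finset (Fin m)} {C : Clause n}
    (hJ : Entails cl J C) :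
    ∃ K ⊆ J, Entails cl K C ∧ boundary cl K ⊆ C.image Prod.fst := by
  induction J using Finset.strongInduction with
  | H J ih =>
    by_cases hmin : ∀ j ∈ J, ¬ Entails cl (J.erase j) C
    · exact ⟨J, subset_rfl, hJ, boundary_subset_of_minimal hJ hmin⟩
    · push Not at hmin
      obtain ⟨j, hj, hE⟩ := hmin
      obtain ⟨K, hK, h⟩ := ih _ (Finset.erase_ssubset hj) hE
      exact ⟨K, hK.trans (Finset.erase_subset _ _), h⟩

theorem Entails.resolve {cl : Fin m → Clause n} {J K : Finset (Fin m)} {C D : Clause n}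
    (hC : Entails cl J C) (hD : Entails cl K D) (x : Fin n) :
    Entails cl (J ∪ K) (C.erase (x, true) ∪ D.erase (x, false)) := by
  intro τ hτ
  obtain ⟨l, hl, hlτ⟩ := hC τ fun j hj => hτ j (Finset.mem_union_left _ hj)
  obtain ⟨l', hl', hlτ'⟩ := hD τ fun j hj => hτ j (Finset.mem_union_right _ hj)
  by_cases h : l = (x, true)
  · refine ⟨l', Finset.mem_union_right _ (Finset.mem_erase.2 ⟨?_, hl'⟩), hlτ'⟩
    rintro rfl
    subst h
    simp_all
  · exact ⟨l, Finset.mem_union_left _ (Finset.mem_erase.2 ⟨h, hl⟩), hlτ⟩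

theorem Derivation.card_le_width {F : CNF n} {C : Clause n} (d : Derivation F C) :
    C.card ≤ d.width := by
  cases d with
  | ax h => exact le_rfl
  | resolve x hC hD d e => exact le_max_left _ _

/-- In a narrow proof no clause needs between `r / 2` and `r` axioms: a minimal entailing set of
that size would put its large boundary into the clause. Premises therefore need at most `r / 2`
axioms each, and a resolvent at most `r`, so the bound propagates. -/
theorem Derivation.entails_or_le_width {cl : Fin m → Clause n} {r : ℕ} (hr : 1 ≤ r) {b : ℝ}
    (hb : 0 < b)
    (hexp : ∀ J : Finset (Fin m), J.Nonempty → J.card ≤ r →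
      b * J.card ≤ (boundary cl J).card)
    {C : Clause n} (d : Derivation (Finset.univ.image cl) C) :
    (∃ J : Finset (Fin m), J.card ≤ r ∧ Entails cl J C) ∨ b * r / 2 ≤ d.width := by
  have key : ∀ {C : Clause n} (d : Derivation (Finset.univ.image cl) C) (J : Finset (Fin m)),
      J.card ≤ r → Entails cl J C →
      (∃ J : Finset (Fin m), 2 * J.card ≤ r ∧ Entails cl J C) ∨ b * r / 2 ≤ d.width := by
    intro C d J hJr hJ
    obtain ⟨K, hKJ, hK, hbd⟩ := exists_minimal_entails hJ
    by_cases h : 2 * K.card ≤ r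
    · exact Or.inl ⟨K, h, hK⟩
    · right
      have hKr : K.card ≤ r := (Finset.card_le_card hKJ).trans hJr
      have h1 := hexp K (Finset.card_pos.1 (by omega)) hKr
      have h2 : (boundary cl K).card ≤ d.width :=
        (Finset.card_le_card hbd).trans (Finset.card_image_le.trans d.card_le_width)
      have h3 : (r : ℝ) ≤ 2 * K.card := by
        push Not at h
        exact_mod_cast h.le
      have h4 : ((boundary cl K).card : ℝ) ≤ d.width := by exact_mod_cast h2
      nlinarith
  induction d with
  | ax h =>
    obtain ⟨j, -, rfl⟩ := Finset.mem_image.1 h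
    exact Or.inl ⟨{j}, by simpa using hr, fun τ hτ => hτ j (by simp)⟩
  | resolve x hC hD d e ihd ihe =>
    have hd : (d.width : ℝ) ≤ (Derivation.resolve x hC hD d e).width := by
      exact_mod_cast le_max_of_le_right (le_max_left _ _)
    have he : (e.width : ℝ) ≤ (Derivation.resolve x hC hD d e).width := by
      exact_mod_cast le_max_of_le_right (le_max_right _ _)
    rcases ihd with ⟨J, hJr, hJ⟩ | h
    swap
    · exact Or.inr (h.trans hd)
    rcases ihe with ⟨K, hKr, hK⟩ | h
    swap
    · exact Or.inr (h.trans he)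
    rcases key d J hJr hJ with ⟨J', hJr', hJ'⟩ | h
    swap
    · exact Or.inr (h.trans hd)
    rcases key e K hKr hK with ⟨K', hKr', hK'⟩ | h
    swap
    · exact Or.inr (h.trans he)
    exact Or.inl ⟨J' ∪ K', (Finset.card_union_le _ _).trans (by omega), hJ'.resolve hK' x⟩

/-- Boundary expansion of small sets of clauses forces large resolution width. -/
theorem ceil_le_resolutionWidth {cl : Fin m → Clause n} {r : ℕ} (hr : 1 ≤ r) {b : ℝ}
    (hb : 0 < b)
    (hexp : ∀ J : Finset (Fin m), J.Nonempty → J.card ≤ r →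
      b * J.card ≤ (boundary cl J).card) {x : ℝ} (hx : x ≤ b * r / 2) :
    (⌈x⌉₊ : ℕ∞) ≤ resolutionWidth (Finset.univ.image cl) := by
  refine le_iInf fun d => ?_
  rcases d.entails_or_le_width hr hb hexp with ⟨J, hJr, hJ⟩ | h
  -- The empty clause cannot follow from `r` or fewer clauses, since expansion lets them be peeled
  -- and satisfied.
  · exfalso
    obtain ⟨τ, hτ⟩ := exists_satClause_of_boundary_nonempty cl J fun K hK hne => by
      have h1 := hexp K hne ((Finset.card_le_card hK).trans hJr)
      have h2 : (0 : ℝ) < K.card := by exact_mod_cast hne.card_pos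
      have h3 : (0 : ℝ) < (boundary cl K).card := (mul_pos hb h2).trans_le h1
      exact Finset.card_pos.1 (by exact_mod_cast h3)
    obtain ⟨l, hl, -⟩ := hJ τ hτ
    simp at hl
  · exact_mod_cast Nat.ceil_le.2 (hx.trans h)

end Resolution

/-! ### Occupancy sums and exponential generating functions -/

section Fibers

open scoped Nat

/-- The number of points that `a` maps to `x`. -/
def fiberCard {P X : Type*} [Fintype P] [DecidableEq X] (a : P → X) (x : X) : ℕ :=
  Fintype.card {p // a p = x}

/-- The sum is `|P|!` times the coefficient of `z ^ |P|` in the product of the exponential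
generating functions of the `f x`. With nonnegative coefficients, it is bounded by evaluation at any
positive `z`. The induction splits off the fibre `D` over the first point. -/
theorem sum_prod_fiberCard_le {n : ℕ} (f : Fin n → ℕ → ℝ) (hf : ∀ x d, 0 ≤ f x d) {z : ℝ}
    (hz : 0 < z) (G : Fin n → ℝ)
    (hG : ∀ x N, ∑ d ∈ Finset.range (N + 1), f x d * z ^ d / d ! ≤ G x)
    (P : Type) [Fintype P] [DecidableEq P] :
    ∑ a : P → Fin n, ∏ x, f x (fiberCard a x) ≤
      (Fintype.card P)! / z ^ Fintype.card P * ∏ x, G x := by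
  induction n generalizing P with
  | zero =>
    rcases isEmpty_or_nonempty P with hP | hP
    · simp
    · have : IsEmpty (P → Fin 0) := ⟨fun a => (a (Classical.arbitrary P)).elim0⟩
      simp only [Finset.univ_eq_empty, Finset.sum_empty, Finset.prod_empty]
      positivity
  | succ n ih =>
    have hG0 : ∀ x, 0 ≤ G x := fun x => le_trans
      (Finset.sum_nonneg fun d _ => by have := hf x d; positivity) (hG x 0)
    have hprod : 0 ≤ ∏ x : Fin n, G x.succ := Finset.prod_nonneg fun x _ => hG0 _
    calc ∑ a : P → Fin (n + 1), ∏ x, f x (fiberCard a x)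
        = ∑ D : Finset P, ∑ a : P → Fin (n + 1) with Finset.univ.filter (a · = 0) = D,
            ∏ x, f x (fiberCard a x) := by
          rw [Finset.sum_fiberwise]
      _ ≤ ∑ D : Finset P, ∑ a : {p // p ∉ D} → Fin n,
            f 0 D.card * ∏ x : Fin n, f x.succ (fiberCard a x) := by
          refine Finset.sum_le_sum fun D _ => le_of_eq ?_
          symm
          -- Maps with fibre exactly `D` over `0` are the maps from the complement of `D` into the
          -- nonzero points, extended by `0` on `D`.
          refine Finset.sum_bij
            (fun a _ p => if h : p ∉ D then (a ⟨p, h⟩).succ else 0) ?_ ?_ ?_ ?_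
          · intro a _
            simp only [Finset.mem_filter, Finset.mem_univ, true_and]
            ext p
            by_cases h : p ∈ D <;> simp [h]
          · intro a _ a' _ h
            ext1 p
            have := congrFun h p
            simpa [p.2] using this
          · intro a ha
            simp only [Finset.mem_filter, Finset.mem_univ, true_and] at ha
            have h0 : ∀ p, p ∉ D → a p ≠ 0 := fun p hp h => hp (by rw [← ha]; simp [h])
            refine ⟨fun p => (a p).pred (h0 p p.2), Finset.mem_univ _, ?_⟩
            ext1 p
            by_cases h : p ∈ D
            · have : a p = 0 := by
                rw [← ha] at h
                simpa using h
              simp [h, this]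
            · simp [h]
          · intro a _
            rw [Fin.prod_univ_succ]
            congr 2
            · rw [fiberCard, Fintype.card_subtype]
              congr 1
              ext p
              by_cases h : p ∈ D <;> simp [h]
            · ext1 x
              congr 1
              refine Fintype.card_congr ⟨fun p => ⟨p.1.1, ?_⟩, fun p => ⟨⟨p.1, ?_⟩, ?_⟩, ?_, ?_⟩
              · have h1 := p.1.2
                have h2 := p.2
                simp [h1, h2]
              · intro h
                have := p.2
                simp [h] at this
                exact (Fin.succ_ne_zero _ this.symm).elim
              · have := p.2
                by_cases h : p.1 ∈ D
                · simp [h] at this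
                  exact (Fin.succ_ne_zero _ this.symm).elim
                · simpa [h] using this
              · intro p
                rfl
              · intro p
                rfl
      _ ≤ ∑ D : Finset P, f 0 D.card *
            ((Fintype.card P - D.card)! / z ^ (Fintype.card P - D.card) *
              ∏ x : Fin n, G x.succ) := by
          refine Finset.sum_le_sum fun D _ => ?_
          rw [← Finset.mul_sum]
          have := ih (fun x => f x.succ) (fun x => hf x.succ) (fun x => G x.succ)
            (fun x => hG x.succ) {p // p ∉ D}
          have hc : Fintype.card {p // p ∉ D} = Fintype.card P - D.card := by
            rw [Fintype.card_subtype_compl]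
            simp
          rw [hc] at this
          exact mul_le_mul_of_nonneg_left this (hf _ _)
      _ = (Fintype.card P)! / z ^ Fintype.card P * ((∏ x : Fin n, G x.succ) *
            ∑ d ∈ Finset.range (Fintype.card P + 1), f 0 d * z ^ d / d !) := by
          have := Finset.sum_powerset_apply_card (fun d => f 0 d *
            ((Fintype.card P - d)! / z ^ (Fintype.card P - d) *
              ∏ x : Fin n, G x.succ)) (x := (Finset.univ : Finset P))
          rw [Finset.powerset_univ] at this
          rw [this, Finset.card_univ, Finset.mul_sum, Finset.mul_sum]
          refine Finset.sum_congr rfl fun d hd => ?_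
          have hd : d ≤ Fintype.card P := Nat.lt_succ_iff.1 (Finset.mem_range.1 hd)
          have h1 : z ^ Fintype.card P = z ^ (Fintype.card P - d) * z ^ d := by
            rw [← pow_add, Nat.sub_add_cancel hd]
          rw [nsmul_eq_mul, Nat.cast_choose ℝ hd, h1]
          field_simp
      _ ≤ (Fintype.card P)! / z ^ Fintype.card P * ∏ x, G x := by
          rw [Fin.prod_univ_succ, mul_comm (G 0)]
          have := hG 0 (Fintype.card P)
          gcongr

theorem exp_sub_self_le_exp_sq {y : ℝ} (hy : 0 ≤ y) : Real.exp y - y ≤ Real.exp (y ^ 2) := by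
  rcases le_total y 1 with h | h
  · have h1 := Real.abs_exp_sub_one_sub_id_le (x := y) (by rwa [abs_of_nonneg hy])
    have h2 := (abs_le.1 h1).2
    have h3 := Real.add_one_le_exp (y ^ 2)
    linarith
  · have : Real.exp y ≤ Real.exp (y ^ 2) := Real.exp_le_exp.2 (by nlinarith)
    linarith

/-- The weight of a fibre of size `d` over a point of weight `q`, where fibres of size one are
discounted by `θ`. -/
noncomputable def fiberWeight (θ q : ℝ) (d : ℕ) : ℝ := q ^ d * if d = 1 then θ else 1

theorem fiberWeight_nonneg {θ q : ℝ} (hθ : 0 ≤ θ) (hq : 0 ≤ q) (d : ℕ) :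
    0 ≤ fiberWeight θ q d := by
  unfold fiberWeight
  split_ifs <;> positivity

theorem sum_fiberWeight_le_exp {θ q z : ℝ} (hθ' : θ ≤ 1) (hq : 0 ≤ q)
    (hz : 0 ≤ z) (N : ℕ) :
    ∑ d ∈ Finset.range (N + 1), fiberWeight θ q d * z ^ d / d ! ≤ Real.exp (q * z) := by
  refine le_trans (Finset.sum_le_sum fun d _ => ?_)
    (Real.sum_le_exp_of_nonneg (mul_nonneg hq hz) (N + 1))
  have : fiberWeight θ q d ≤ q ^ d := by
    unfold fiberWeight
    refine mul_le_of_le_one_right (by positivity) ?_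
    split_ifs <;> simp [hθ']
  rw [mul_pow]
  gcongr

/-- Discounting size-one fibres turns the exponential series in `y = q * z` into `exp y - y + θ *
y`; without its linear term `exp y` is at most `exp (y ^ 2)`. -/
theorem sum_fiberWeight_le_exp_sq {θ q z : ℝ} (hθ : 0 ≤ θ) (hq : 0 ≤ q) (hz : 0 ≤ z) (N : ℕ) :
    ∑ d ∈ Finset.range (N + 1), fiberWeight θ q d * z ^ d / d ! ≤
      Real.exp ((q * z) ^ 2 + θ * (q * z)) := by
  have hy : 0 ≤ q * z := mul_nonneg hq hz
  -- For `N = 0` the sum has no linear term to replace, so the identity `h1` would fail.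
  rcases N with _ | N
  · simp only [fiberWeight, zero_add, Finset.range_one, Finset.sum_singleton, pow_zero,
      Nat.factorial_zero]
    simp only [zero_ne_one, if_false]
    have : 0 ≤ (q * z) ^ 2 + θ * (q * z) := by positivity
    simpa using this
  · have h1 : ∑ d ∈ Finset.range (N + 1 + 1), fiberWeight θ q d * z ^ d / d ! =
        (∑ d ∈ Finset.range (N + 1 + 1), (q * z) ^ d / d !) - q * z + θ * (q * z) := by
      have : ∀ d ∈ Finset.range (N + 1 + 1), fiberWeight θ q d * z ^ d / d ! =
          (q * z) ^ d / d ! + if d = 1 then θ * (q * z) - q * z else 0 := by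
        intro d _
        unfold fiberWeight
        split_ifs with h
        · subst h
          simp
          ring
        · rw [mul_pow]
          ring
      rw [Finset.sum_congr rfl this, Finset.sum_add_distrib, Finset.sum_ite_eq']
      simp
      ring
    have h2 := Real.sum_le_exp_of_nonneg hy (N + 1 + 1)
    have h3 := exp_sub_self_le_exp_sq hy
    have h4 := Real.add_one_le_exp (θ * (q * z))
    have h5 : 1 ≤ Real.exp ((q * z) ^ 2) := Real.one_le_exp (by positivity)
    have h6 : 0 ≤ θ * (q * z) := by positivity
    rw [h1, Real.exp_add]
    nlinarith

theorem prod_fiberWeight_fiberCard {P : Type*} [Fintype P] {n : ℕ} (θ : ℝ)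
    (q : Fin n → ℝ) (a : P → Fin n) :
    ∏ x, fiberWeight θ (q x) (fiberCard a x) =
      (∏ p, q (a p)) * θ ^ (Finset.univ.filter fun x => fiberCard a x = 1).card := by
  classical
  simp only [fiberWeight, Finset.prod_mul_distrib]
  congr 1
  · rw [← Finset.prod_fiberwise_of_maps_to (s := Finset.univ) (t := Finset.univ) (g := a)
      (fun _ _ => Finset.mem_univ _)]
    refine Finset.prod_congr rfl fun x _ => ?_
    rw [Finset.prod_congr rfl (g := fun _ => q x)
      fun p hp => by rw [(Finset.mem_filter.1 hp).2]]
    rw [Finset.prod_const, fiberCard, Fintype.card_subtype]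
  · rw [Finset.prod_ite, Finset.prod_const, Finset.prod_const_one, mul_one]

/-- An exponential bound for the discounted mass of all maps into a weighted finite set; the
points in `H` are treated as heavy. -/
theorem sum_prod_mul_pow_unique_le {n : ℕ} (q : Fin n → ℝ) (hq : ∀ x, 0 ≤ q x) {θ z : ℝ}
    (hθ : 0 ≤ θ) (hθ' : θ ≤ 1) (hz : 0 < z) (H : Finset (Fin n))
    (P : Type) [Fintype P] [DecidableEq P] :
    ∑ a : P → Fin n,
        (∏ p, q (a p)) * θ ^ (Finset.univ.filter fun x => fiberCard a x = 1).card ≤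
      (Fintype.card P)! / z ^ Fintype.card P *
        Real.exp (z * ∑ x ∈ H, q x + z ^ 2 * ∑ x ∈ Hᶜ, q x ^ 2 + θ * z * ∑ x, q x) := by
  have h := sum_prod_fiberCard_le (fun x => fiberWeight θ (q x))
    (fun x => fiberWeight_nonneg hθ (hq x)) hz
    (fun x => Real.exp (if x ∈ H then q x * z else (q x * z) ^ 2 + θ * (q x * z)))
    (fun x N => by
      by_cases hx : x ∈ H
      · simpa only [hx, if_true] using sum_fiberWeight_le_exp hθ' (hq x) hz.le N
      · simpa only [hx, if_false] using sum_fiberWeight_le_exp_sq hθ (hq x) hz.le N) P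
  simp only [prod_fiberWeight_fiberCard] at h
  refine h.trans ?_
  rw [← Real.exp_sum]
  refine mul_le_mul_of_nonneg_left (Real.exp_le_exp.2 ?_) (by positivity)
  rw [← Finset.sum_add_sum_compl H, Finset.sum_congr rfl (g := fun x => z * q x)
    fun x hx => by rw [if_pos hx, mul_comm], Finset.sum_congr (s₁ := Hᶜ) rfl
    (g := fun x => z ^ 2 * q x ^ 2 + θ * z * q x)
    fun x hx => by rw [if_neg (Finset.mem_compl.1 hx)]; ring]
  rw [Finset.sum_add_distrib, ← Finset.mul_sum, ← Finset.mul_sum, ← Finset.mul_sum]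
  have : ∑ x ∈ Hᶜ, q x ≤ ∑ x, q x :=
    Finset.sum_le_sum_of_subset_of_nonneg (Finset.subset_univ _) fun x _ _ => hq x
  have : θ * z * ∑ x ∈ Hᶜ, q x ≤ θ * z * ∑ x, q x := by gcongr
  linarith

end Fibers

/-! ### The random model and Markov's inequality for unique positions -/

section Probability

variable {k n m : ℕ} {β : ℝ}

theorem weight_pos (β : ℝ) (i : Fin n) : 0 < weight β i := by
  unfold weight
  positivity

theorem varsMass_nonneg (β : ℝ) (v : Fin k ↪ Fin n) : 0 ≤ varsMass β v :=
  Finset.prod_nonneg fun _ _ =>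
    div_nonneg (weight_pos β _).le (Finset.sum_nonneg fun _ _ => (weight_pos β _).le)

theorem drawMass_nonneg (β : ℝ) (c : Draw k n) : 0 ≤ drawMass β c :=
  mul_nonneg (varsMass_nonneg β _) (by positivity)

theorem sampleMass_nonneg (β : ℝ) (Φ : Sample k n m) : 0 ≤ sampleMass β Φ :=
  Finset.prod_nonneg fun _ _ => drawMass_nonneg β _

open scoped Classical in
theorem prob_eq_sum_ite (A : Set (Sample k n m)) :
    prob β A = ∑ Φ : Sample k n m, if Φ ∈ A then sampleMass β Φ else 0 :=
  Finset.sum_filter _ _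

theorem prob_nonneg (A : Set (Sample k n m)) : 0 ≤ prob β A :=
  Finset.sum_nonneg fun _ _ => sampleMass_nonneg β _

theorem prob_mono {A B : Set (Sample k n m)} (h : A ⊆ B) : prob β A ≤ prob β B := by
  classical
  unfold prob
  exact Finset.sum_le_sum_of_subset_of_nonneg
    (fun Φ hΦ => by simp only [Finset.mem_filter] at hΦ ⊢; exact ⟨hΦ.1, h hΦ.2⟩)
    fun _ _ _ => sampleMass_nonneg β _

theorem prob_inter_add_diff (A B : Set (Sample k n m)) :
    prob β (A ∩ B) + prob β (B \ A) = prob β B := by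
  classical
  simp only [prob_eq_sum_ite, ← Finset.sum_add_distrib]
  refine Finset.sum_congr rfl fun Φ _ => ?_
  by_cases hA : Φ ∈ A <;> by_cases hB : Φ ∈ B <;> simp [hA, hB]

theorem prob_le_sum_of_subset {ι : Type*} (s : Finset ι) (A : Set (Sample k n m))
    (B : ι → Set (Sample k n m)) (h : ∀ Φ ∈ A, ∃ i ∈ s, Φ ∈ B i) :
    prob β A ≤ ∑ i ∈ s, prob β (B i) := by
  classical
  simp only [prob_eq_sum_ite]
  rw [Finset.sum_comm]
  refine Finset.sum_le_sum fun Φ _ => ?_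
  have h0 : ∀ i ∈ s, 0 ≤ if Φ ∈ B i then sampleMass β Φ else 0 := fun i _ => by
    split_ifs
    exacts [sampleMass_nonneg β Φ, le_rfl]
  split_ifs with hA
  · obtain ⟨i, hi, hB⟩ := h Φ hA
    exact (if_pos hB).symm.le.trans (Finset.single_le_sum h0 hi)
  · exact Finset.sum_nonneg h0

/-- The mass of a sequence of variables, extended by zero to sequences with repetitions. -/
noncomputable def seqMass (β : ℝ) {k n : ℕ} (v : Fin k → Fin n) : ℝ :=
  ∏ t : Fin k, if ∀ s < t, v s ≠ v t then
    weight β (v t) / ∑ i : Fin n with ∀ s < t, v s ≠ i, weight β i else 0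

theorem seqMass_nonneg (β : ℝ) (v : Fin k → Fin n) : 0 ≤ seqMass β v :=
  Finset.prod_nonneg fun _ _ => by
    split_ifs
    exacts [div_nonneg (weight_pos β _).le (Finset.sum_nonneg fun _ _ => (weight_pos β _).le),
      le_rfl]

theorem seqMass_coe (v : Fin k ↪ Fin n) : seqMass β v = varsMass β v := by
  refine Finset.prod_congr rfl fun t _ => if_pos fun s hs h => hs.ne (v.injective h)

/-- Summing out the last draw gives a total divided by itself. This is at most one even when no
variable is left, so `k ≤ n` is not needed. -/
theorem sum_seqMass_le_one (β : ℝ) (k n : ℕ) : ∑ v : Fin k → Fin n, seqMass β v ≤ 1 := by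
  induction k with
  | zero => simp [seqMass]
  | succ k ih =>
    rw [← (Fin.snocEquiv fun _ : Fin (k + 1) => Fin n).sum_comp, Fintype.sum_prod_type_right]
    refine le_trans (Finset.sum_le_sum fun v _ => ?_) ih
    have h1 : ∀ x : Fin n, seqMass β (Fin.snocEquiv (fun _ : Fin (k + 1) => Fin n) (x, v)) =
        seqMass β v * if ∀ s, v s ≠ x then
          weight β x / ∑ i : Fin n with ∀ s, v s ≠ i, weight β i else 0 := by
      intro x
      rw [seqMass, Fin.prod_univ_castSucc]
      simp [seqMass, Fin.forall_fin_succ', Fin.castSucc_lt_last, Fin.snocEquiv,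
        (Fin.castSucc_lt_last _).not_gt]
    simp only [h1]
    rw [← Finset.mul_sum, ← Finset.sum_filter, ← Finset.sum_div]
    exact mul_le_of_le_one_right (seqMass_nonneg β v) (div_self_le_one _)

theorem sum_varsMass_le_one (β : ℝ) (k n : ℕ) : ∑ v : Fin k ↪ Fin n, varsMass β v ≤ 1 := by
  refine le_trans ?_ (sum_seqMass_le_one β k n)
  have := Finset.sum_map (Finset.univ : Finset (Fin k ↪ Fin n))
    ⟨fun v => (v : Fin k → Fin n), DFunLike.coe_injective⟩ (seqMass β)
  simp only [Function.Embedding.coeFn_mk, seqMass_coe] at this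
  rw [← this]
  exact Finset.sum_le_sum_of_subset_of_nonneg (Finset.subset_univ _)
    fun v _ _ => seqMass_nonneg β v

theorem sum_drawMass (β : ℝ) (v : Fin k ↪ Fin n) :
    ∑ σ : Fin k → Bool, drawMass β (v, σ) = varsMass β v := by
  simp only [drawMass, Finset.sum_const, Finset.card_univ, Fintype.card_pi, Fintype.card_bool,
    Finset.prod_const, Fintype.card_fin, nsmul_eq_mul, one_div, inv_pow]
  push_cast
  field_simp

theorem sum_drawMass_le_one (β : ℝ) (k n : ℕ) : ∑ c : Draw k n, drawMass β c ≤ 1 := by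
  rw [Fintype.sum_prod_type]
  simp only [sum_drawMass]
  exact sum_varsMass_le_one β k n

theorem sum_drawMass_fiber_le {q : Fin n → ℝ} (hq : ∀ x, 0 ≤ q x)
    (hvq : ∀ v : Fin k ↪ Fin n, varsMass β v ≤ ∏ t, q (v t)) (v : Fin k → Fin n) :
    ∑ c : Draw k n with (c.1 : Fin k → Fin n) = v, drawMass β c ≤ ∏ t, q (v t) := by
  rw [Finset.sum_filter, Fintype.sum_prod_type]
  have : ∀ u : Fin k ↪ Fin n, (∑ σ : Fin k → Bool,
      if (u : Fin k → Fin n) = v then drawMass β (u, σ) else 0) =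
      if (u : Fin k → Fin n) = v then varsMass β u else 0 := by
    intro u
    split_ifs
    exacts [sum_drawMass β u, Finset.sum_const_zero]
  simp only [this]
  by_cases h : ∃ u : Fin k ↪ Fin n, (u : Fin k → Fin n) = v
  · obtain ⟨u, rfl⟩ := h
    simp only [DFunLike.coe_fn_eq, Finset.sum_ite_eq', Finset.mem_univ, if_true]
    exact hvq u
  · push Not at h
    rw [Finset.sum_eq_zero fun u _ => if_neg (h u)]
    exact Finset.prod_nonneg fun t _ => hq _

/-- Replacing the law of independent random variables by a dominating measure. -/
theorem sum_prod_comp_le {J D V : Type*} [Fintype J] [Fintype D] [Fintype V] [DecidableEq J]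
    [DecidableEq V] (π : D → V) (μ : D → ℝ) (ν : V → ℝ) (hμ : ∀ c, 0 ≤ μ c)
    (h : ∀ v, ∑ c with π c = v, μ c ≤ ν v) (g : (J → V) → ℝ) (hg : ∀ v, 0 ≤ g v) :
    ∑ Φ : J → D, (∏ j, μ (Φ j)) * g (fun j => π (Φ j)) ≤
      ∑ v : J → V, (∏ j, ν (v j)) * g v := by
  rw [← Finset.sum_fiberwise (s := Finset.univ) (g := fun (Φ : J → D) j => π (Φ j))]
  refine Finset.sum_le_sum fun v _ => ?_
  rw [Finset.sum_congr rfl (g := fun Φ => (∏ j, μ (Φ j)) * g v)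
    fun Φ hΦ => by rw [(Finset.mem_filter.1 hΦ).2], ← Finset.sum_mul]
  refine mul_le_mul_of_nonneg_right ?_ (hg v)
  have h1 : (Finset.univ.filter fun Φ : J → D => (fun j => π (Φ j)) = v) =
      Fintype.piFinset fun j => Finset.univ.filter fun c => π c = v j := by
    ext Φ
    simp [funext_iff]
  rw [h1, ← Finset.prod_univ_sum]
  exact Finset.prod_le_prod (fun j _ => Finset.sum_nonneg fun c _ => hμ c) fun j _ => h _

/-- Independent coordinates outside `J` can be summed out. -/
theorem sum_prod_restrict_le {D : Type*} [Fintype D] (μ : D → ℝ) (hμ : ∀ c, 0 ≤ μ c)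
    (h : ∑ c, μ c ≤ 1) (J : Finset (Fin m)) (g : (J → D) → ℝ) (hg : ∀ Φ, 0 ≤ g Φ) :
    ∑ Φ : Fin m → D, (∏ j, μ (Φ j)) * g (fun j => Φ j) ≤
      ∑ Φ : J → D, (∏ j, μ (Φ j)) * g Φ := by
  rw [← (Equiv.piEquivPiSubtypeProd (· ∈ J) fun _ => D).symm.sum_comp, Fintype.sum_prod_type]
  refine Finset.sum_le_sum fun Φ _ => ?_
  have h1 : ∀ Ψ : {j // j ∉ J} → D,
      (∏ j, μ ((Equiv.piEquivPiSubtypeProd (· ∈ J) fun _ => D).symm (Φ, Ψ) j)) *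
        g (fun j => (Equiv.piEquivPiSubtypeProd (· ∈ J) fun _ => D).symm (Φ, Ψ) j) =
      ((∏ j, μ (Φ j)) * g Φ) * ∏ j, μ (Ψ j) := by
    intro Ψ
    have h2 : (fun j : J => (Equiv.piEquivPiSubtypeProd (· ∈ J) fun _ => D).symm (Φ, Ψ) j) =
        Φ := by
      ext1 j
      simp [Equiv.piEquivPiSubtypeProd]
    rw [h2, ← Fintype.prod_subtype_mul_prod_subtype (· ∈ J), mul_right_comm]
    refine congrArg₂ (· * ·) (congrArg (· * g Φ) ?_) ?_
    · refine Finset.prod_congr (by ext; simp) fun j _ => ?_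
      simp [Equiv.piEquivPiSubtypeProd]
    · refine Finset.prod_congr rfl fun j _ => ?_
      simp [Equiv.piEquivPiSubtypeProd, j.2]
  simp only [h1]
  rw [← Finset.mul_sum]
  refine mul_le_of_le_one_right
    (mul_nonneg (Finset.prod_nonneg fun j _ => hμ _) (hg _)) ?_
  have h3 := (Finset.prod_univ_sum (fun _ : {j // j ∉ J} => (Finset.univ : Finset D))
    fun _ c => μ c)
  rw [Fintype.piFinset_univ] at h3
  rw [← h3]
  exact Finset.prod_le_one (fun _ _ => Finset.sum_nonneg fun c _ => hμ c) fun _ _ => h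

/-- The variable at each position of the clauses with index in `J`. -/
def positions (Φ : Sample k n m) (J : Finset (Fin m)) (p : J × Fin k) : Fin n :=
  (Φ p.1).1 p.2

/-- The clause with index `j`. -/
def Sample.clause (Φ : Sample k n m) (j : Fin m) : Clause n :=
  Finset.univ.image fun t : Fin k => (((Φ j).1 t, (Φ j).2 t) : Literal n)

theorem unique_subset_boundary (Φ : Sample k n m) (J : Finset (Fin m)) :
    (Finset.univ.filter fun x => fiberCard (positions Φ J) x = 1) ⊆ boundary Φ.clause J := by
  classical
  intro x hx
  simp only [Finset.mem_filter, Finset.mem_univ, true_and, boundary] at hx ⊢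
  rw [fiberCard, Fintype.card_eq_one_iff] at hx
  obtain ⟨⟨⟨⟨j, hj⟩, t⟩, hp⟩, hu⟩ := hx
  refine ⟨j, ⟨hj, (Φ j).2 t, Finset.mem_image.2 ⟨t, Finset.mem_univ _, ?_⟩⟩, ?_⟩
  · exact Prod.ext hp rfl
  · rintro i ⟨hi, b, hb⟩
    obtain ⟨s, -, hs⟩ := Finset.mem_image.1 hb
    have := hu ⟨⟨⟨i, hi⟩, s⟩, congrArg Prod.fst hs⟩
    exact congrArg (fun p => (p.1.1 : Fin m)) this

/-- The clauses with index in `J` contain fewer than `b * |J|` variables at a unique position. -/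
def fewUnique (k n m : ℕ) (b : ℝ) (J : Finset (Fin m)) : Set (Sample k n m) :=
  {Φ | ((Finset.univ.filter fun x => fiberCard (positions Φ J) x = 1).card : ℝ) < b * J.card}

open scoped Nat in
-- Markov's inequality for `θ ^ U`, with `U` the number of unique positions. Clauses outside `J` are
-- summed out, the law is replaced by the dominating product, and the rest is an occupancy sum over
-- `J × Fin k`.
theorem prob_fewUnique_le {q : Fin n → ℝ} (hq : ∀ x, 0 ≤ q x)
    (hvq : ∀ v : Fin k ↪ Fin n, varsMass β v ≤ ∏ t, q (v t)) {θ z : ℝ} (hθ : 0 < θ)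
    (hθ' : θ ≤ 1) (hz : 0 < z) (H : Finset (Fin n)) (b : ℝ) (J : Finset (Fin m)) :
    prob β (fewUnique k n m b J) ≤ θ ^ (-(b * J.card)) *
      ((J.card * k)! / z ^ (J.card * k) *
        Real.exp (z * ∑ x ∈ H, q x + z ^ 2 * ∑ x ∈ Hᶜ, q x ^ 2 + θ * z * ∑ x, q x)) := by
  classical
  set U : (J × Fin k → Fin n) → ℕ := fun a =>
    (Finset.univ.filter fun x => fiberCard a x = 1).card with hU
  have hJ : Fintype.card (J × Fin k) = J.card * k := by simp
  have h1 := sum_prod_mul_pow_unique_le q hq hθ.le hθ' hz H (J × Fin k)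
  rw [hJ] at h1
  have h2 : ∑ v : J → Fin k → Fin n, (∏ j, ∏ t, q (v j t)) * θ ^ U (fun p => v p.1 p.2) =
      ∑ a : J × Fin k → Fin n, (∏ p, q (a p)) * θ ^ U a := by
    rw [← (Equiv.curry J (Fin k) (Fin n)).sum_comp]
    refine Finset.sum_congr rfl fun a _ => ?_
    rw [Fintype.prod_prod_type]
    rfl
  have h3 := sum_prod_comp_le (J := J) (fun c : Draw k n => (c.1 : Fin k → Fin n)) (drawMass β)
    (fun v => ∏ t, q (v t)) (drawMass_nonneg β) (sum_drawMass_fiber_le hq hvq)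
    (fun v => θ ^ U (fun p => v p.1 p.2)) fun v => by positivity
  have h4 := sum_prod_restrict_le (drawMass β) (drawMass_nonneg β) (sum_drawMass_le_one β k n) J
    (fun Φ => θ ^ U (fun p => (Φ p.1).1 p.2)) fun v => by positivity
  calc prob β (fewUnique k n m b J)
      ≤ ∑ Φ : Sample k n m, θ ^ (-(b * J.card)) * (sampleMass β Φ * θ ^ U (positions Φ J)) := by
        rw [prob_eq_sum_ite]
        refine Finset.sum_le_sum fun Φ _ => ?_
        have h0 := sampleMass_nonneg β Φ
        split_ifs with h
        · have h5 : (1 : ℝ) ≤ θ ^ (-(b * J.card)) * θ ^ U (positions Φ J) := by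
            rw [← Real.rpow_natCast, ← Real.rpow_add hθ]
            refine Real.one_le_rpow_of_pos_of_le_one_of_nonpos hθ hθ' ?_
            have : (U (positions Φ J) : ℝ) < b * J.card := h
            linarith
          calc sampleMass β Φ ≤ sampleMass β Φ *
                (θ ^ (-(b * J.card)) * θ ^ U (positions Φ J)) := le_mul_of_one_le_right h0 h5
            _ = _ := by ring
        · positivity
    _ = θ ^ (-(b * J.card)) * ∑ Φ : Sample k n m, sampleMass β Φ * θ ^ U (positions Φ J) := by
        rw [Finset.mul_sum]
    _ ≤ _ := by
        refine mul_le_mul_of_nonneg_left ?_ (by positivity)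
        refine le_trans h4 (h3.trans ?_)
        exact h2.le.trans h1

end Probability

/-! ### Partial sums and tails of powers -/

section PowerSums

/-- Bernoulli's inequality replaces comparison with an integral: `s ^ a ≤ (s + 1) ^ a * (1 - a / (s
+ 1))`. -/
theorem sum_rpow_sub_one_le {a : ℝ} (ha : 0 < a) (ha1 : a ≤ 1) (s : ℕ) :
    ∑ j ∈ Finset.range s, ((j : ℝ) + 1) ^ (a - 1) ≤ (s : ℝ) ^ a / a := by
  induction s with
  | zero => simp [Real.zero_rpow ha.ne']
  | succ s ih =>
    rw [Finset.sum_range_succ]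
    have ht : (0 : ℝ) < s + 1 := by positivity
    have h1 : (s : ℝ) = (s + 1) * (1 + -(1 / (s + 1))) := by
      field_simp
      ring
    have h2 : (-1 : ℝ) ≤ -(1 / (s + 1)) := by
      rw [neg_le_neg_iff, div_le_one ht]
      linarith [(Nat.cast_nonneg s : (0 : ℝ) ≤ s)]
    have h3 := rpow_one_add_le_one_add_mul_self h2 ha.le ha1
    have h4 : (s : ℝ) ^ a = (s + 1 : ℝ) ^ a * (1 + -(1 / ((s : ℝ) + 1))) ^ a := by
      rw [← Real.mul_rpow ht.le (by linarith), ← h1]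
    have h5 : (s : ℝ) ^ a ≤ (s + 1 : ℝ) ^ a * (1 + a * -(1 / (s + 1))) := by
      rw [h4]
      gcongr
    have h6 : ((s : ℝ) + 1) ^ (a - 1) = (s + 1 : ℝ) ^ a / (s + 1) := by
      rw [Real.rpow_sub ht, Real.rpow_one]
    rw [le_div_iff₀ ha] at ih ⊢
    rw [h6]
    push_cast
    have h7 : (s + 1 : ℝ) ^ a * (1 + a * -(1 / (s + 1))) =
        (s + 1 : ℝ) ^ a - (s + 1 : ℝ) ^ a / (s + 1) * a := by
      field_simp
      ring
    nlinarith

theorem sum_Ico_rpow_le {η : ℝ} (hη : 0 < η) {s n : ℕ} (hs : 1 ≤ s) (hsn : s ≤ n) :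
    ∑ j ∈ Finset.Ico s n, ((j : ℝ) + 1) ^ (-1 - η) ≤ ((s : ℝ) ^ (-η) - (n : ℝ) ^ (-η)) / η := by
  induction n, hsn using Nat.le_induction with
  | base => simp
  | succ n hn ih =>
    rw [Finset.sum_Ico_succ_top hn]
    have hn0 : (0 : ℝ) < n := by exact_mod_cast hs.trans hn
    have ht : (0 : ℝ) < n + 1 := by positivity
    have h1 : (n : ℝ) ≤ (n + 1) * Real.exp (-(1 / (n + 1))) := by
      have := Real.add_one_le_exp (-(1 / ((n : ℝ) + 1)))
      calc (n : ℝ) = (n + 1) * (-(1 / (n + 1)) + 1) := by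
            field_simp
            ring
        _ ≤ _ := by gcongr
    have h2 : (n + 1 : ℝ) ^ (-η) * (1 + η / (n + 1)) ≤ (n : ℝ) ^ (-η) := by
      calc (n + 1 : ℝ) ^ (-η) * (1 + η / (n + 1))
          ≤ (n + 1 : ℝ) ^ (-η) * Real.exp (η / (n + 1)) := by
            gcongr
            linarith [Real.add_one_le_exp (η / ((n : ℝ) + 1))]
        _ = ((n + 1) * Real.exp (-(1 / (n + 1)))) ^ (-η) := by
            rw [Real.mul_rpow ht.le (Real.exp_pos _).le, ← Real.exp_mul]
            congr 2
            ring
        _ ≤ (n : ℝ) ^ (-η) := Real.rpow_le_rpow_of_nonpos hn0 h1 (by linarith)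
    have h3 : ((n : ℝ) + 1) ^ (-1 - η) = (n + 1 : ℝ) ^ (-η) / (n + 1) := by
      rw [show -1 - η = -η - 1 by ring, Real.rpow_sub ht, Real.rpow_one]
    rw [le_div_iff₀ hη] at ih ⊢
    rw [h3]
    push_cast
    have h4 : (n + 1 : ℝ) ^ (-η) * (1 + η / (n + 1)) =
        (n + 1 : ℝ) ^ (-η) + (n + 1 : ℝ) ^ (-η) / (n + 1) * η := by
      field_simp
    nlinarith

end PowerSums

/-! ### Domination by power weights and the bound for a fixed clause set -/

section DominatingWeights

/-- Weights with exponent `a - 1` that dominate the law of a drawn variable. -/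
noncomputable def domWeight (a : ℝ) {n : ℕ} (x : Fin n) : ℝ :=
  2 * (n : ℝ) ^ (-a) * ((x : ℕ) + 1 : ℝ) ^ (a - 1)

theorem domWeight_nonneg (a : ℝ) {n : ℕ} (x : Fin n) : 0 ≤ domWeight a x := by
  unfold domWeight
  positivity

/-- At least `n / 2` variables remain, each at least as heavy as the lightest one. As `(x + 1) / n ≤
1`, lowering the exponent to `a - 1` only increases the bound; this freedom allows `a < 1/2` for
every `β`. -/
theorem weight_div_sum_le {β a : ℝ} (hβ : 1 < β) (ha : a ≤ (β - 2) / (β - 1)) {k n : ℕ}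
    (hn : 2 * k ≤ n) (x : Fin n) (S : Finset (Fin n)) (hS : n ≤ S.card + k) :
    weight β x / ∑ i ∈ S, weight β i ≤ domWeight a x := by
  have hn0 : 0 < n := x.pos
  have hn' : (0 : ℝ) < n := by exact_mod_cast hn0
  set γ : ℝ := -1 / (β - 1) with hγ
  have hβ1 : 0 < β - 1 := by linarith
  have hγ0 : γ ≤ 0 := by
    rw [hγ]
    exact div_nonpos_of_nonpos_of_nonneg (by norm_num) hβ1.le
  have hγa : a - 1 ≤ γ := by
    have : (β - 2) / (β - 1) = 1 + γ := by
      rw [hγ]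
      field_simp
      ring
    linarith
  have h1 : (n : ℝ) / 2 * (n : ℝ) ^ γ ≤ ∑ i ∈ S, weight β i := by
    have h2 : ∀ i ∈ S, (n : ℝ) ^ γ ≤ weight β i := fun i _ => by
      refine Real.rpow_le_rpow_of_nonpos (by positivity) ?_ hγ0
      exact_mod_cast i.2
    have h3 := Finset.card_nsmul_le_sum S _ _ h2
    rw [nsmul_eq_mul] at h3
    refine le_trans ?_ h3
    have h4 : (n : ℝ) ≤ S.card + k := by exact_mod_cast hS
    have h5 : (2 : ℝ) * k ≤ n := by exact_mod_cast hn
    gcongr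
    linarith
  have hx0 : (0 : ℝ) < (x : ℕ) + 1 := by positivity
  have hx1 : ((x : ℕ) + 1 : ℝ) / n ≤ 1 := by
    rw [div_le_one hn']
    exact_mod_cast x.2
  calc weight β x / ∑ i ∈ S, weight β i
      ≤ weight β x / ((n : ℝ) / 2 * (n : ℝ) ^ γ) :=
        div_le_div_of_nonneg_left (weight_pos β x).le (by positivity) h1
    _ = 2 / n * (((x : ℕ) + 1 : ℝ) / n) ^ γ := by
        rw [Real.div_rpow hx0.le hn'.le]
        unfold weight
        rw [← hγ]
        field_simp
    _ ≤ 2 / n * (((x : ℕ) + 1 : ℝ) / n) ^ (a - 1) := by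
        gcongr 2 / n * ?_
        exact Real.rpow_le_rpow_of_exponent_ge (by positivity) hx1 hγa
    _ = domWeight a x := by
        rw [Real.div_rpow hx0.le hn'.le, domWeight, Real.rpow_sub hn' a 1, Real.rpow_one,
          Real.rpow_neg hn'.le]
        field_simp

theorem varsMass_le_prod_domWeight {β a : ℝ} (hβ : 1 < β) (ha : a ≤ (β - 2) / (β - 1)) {k n : ℕ}
    (hn : 2 * k ≤ n) (v : Fin k ↪ Fin n) : varsMass β v ≤ ∏ t, domWeight a (v t) := by
  refine Finset.prod_le_prod (fun t _ => div_nonneg (weight_pos β _).le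
    (Finset.sum_nonneg fun _ _ => (weight_pos β _).le)) fun t _ => ?_
  refine weight_div_sum_le hβ ha hn _ _ ?_
  have h1 : (Finset.univ : Finset (Fin n)) ⊆
      (Finset.univ.filter fun i => ∀ s < t, v s ≠ i) ∪ Finset.univ.image v := by
    intro i _
    by_cases h : ∃ s, v s = i
    · obtain ⟨s, rfl⟩ := h
      exact Finset.mem_union_right _ (Finset.mem_image_of_mem _ (Finset.mem_univ _))
    · push Not at h
      exact Finset.mem_union_left _ (by simpa using fun s _ => h s)
  have h2 := (Finset.card_le_card h1).trans (Finset.card_union_le _ _)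
  have h3 : (Finset.univ.image v).card ≤ k := Finset.card_image_le.trans (by simp)
  rw [Finset.card_univ, Fintype.card_fin] at h2
  omega

variable {a : ℝ} {n : ℕ}

theorem sum_domWeight_lt_le (ha : 0 < a) (ha1 : a ≤ 1) {i : ℕ} (hi : i ≤ n) :
    ∑ x ∈ Finset.univ.filter fun x : Fin n => (x : ℕ) < i, domWeight a x ≤ 2 / a * ((i : ℝ) / n) ^ a := by
  have h1 : ∑ x ∈ Finset.univ.filter fun x : Fin n => (x : ℕ) < i, domWeight a x =
      ∑ j ∈ Finset.range i, 2 * (n : ℝ) ^ (-a) * ((j : ℝ) + 1) ^ (a - 1) := by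
    rw [Finset.sum_filter]
    have := Fin.sum_univ_eq_sum_range (fun j => if j < i then
      2 * (n : ℝ) ^ (-a) * ((j : ℝ) + 1) ^ (a - 1) else 0) n
    simp only [domWeight]
    rw [this, ← Finset.sum_filter]
    congr 1
    ext j
    simp only [Finset.mem_filter, Finset.mem_range]
    omega
  rw [h1, ← Finset.mul_sum]
  calc 2 * (n : ℝ) ^ (-a) * ∑ j ∈ Finset.range i, ((j : ℝ) + 1) ^ (a - 1)
      ≤ 2 * (n : ℝ) ^ (-a) * ((i : ℝ) ^ a / a) := by
        gcongr
        exact sum_rpow_sub_one_le ha ha1 i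
    _ = _ := by
        rw [Real.div_rpow (by positivity) (by positivity), Real.rpow_neg (by positivity)]
        ring

theorem sum_domWeight_le (ha : 0 < a) (ha1 : a ≤ 1) : ∑ x : Fin n, domWeight a x ≤ 2 / a := by
  have h := sum_domWeight_lt_le (n := n) ha ha1 le_rfl
  rw [Finset.filter_true_of_mem fun x _ => x.2] at h
  refine h.trans (mul_le_of_le_one_right (by positivity) ?_)
  exact Real.rpow_le_one (by positivity) (div_self_le_one _) ha.le

/-- For `a < 1/2` the squared weights decay with exponent `2 * a - 2 < -1`, so the tail is governed
by its start at `i`. -/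
theorem sum_domWeight_sq_ge_le (ha2 : a < 1 / 2) {i : ℕ} (hi0 : 1 ≤ i)
    (hi : i ≤ n) :
    ∑ x ∈ (Finset.univ.filter fun x : Fin n => (x : ℕ) < i)ᶜ, domWeight a x ^ 2 ≤
      4 / (1 - 2 * a) * (((i : ℝ) / n) ^ a) ^ 2 / i := by
  have hη : 0 < 1 - 2 * a := by linarith
  have hi' : (0 : ℝ) < i := by exact_mod_cast hi0
  have hn' : (0 : ℝ) < n := by exact_mod_cast hi0.trans hi
  have h0 : ∀ j : ℕ, (2 * (n : ℝ) ^ (-a) * ((j : ℝ) + 1) ^ (a - 1)) ^ 2 =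
      4 * ((n : ℝ) ^ (-a)) ^ 2 * ((j : ℝ) + 1) ^ (-1 - (1 - 2 * a)) := by
    intro j
    rw [mul_pow, mul_pow, ← Real.rpow_mul_natCast (x := (j : ℝ) + 1) (by positivity)]
    norm_num
    left
    congr 1
    ring
  have h1 : ∑ x ∈ (Finset.univ.filter fun x : Fin n => (x : ℕ) < i)ᶜ, domWeight a x ^ 2 =
      ∑ j ∈ Finset.Ico i n, 4 * ((n : ℝ) ^ (-a)) ^ 2 * ((j : ℝ) + 1) ^ (-1 - (1 - 2 * a)) := by
    rw [Finset.compl_filter, Finset.sum_filter]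
    have := Fin.sum_univ_eq_sum_range (fun j => if ¬ j < i then
      (2 * (n : ℝ) ^ (-a) * ((j : ℝ) + 1) ^ (a - 1)) ^ 2 else 0) n
    simp only [domWeight]
    rw [this, ← Finset.sum_filter]
    simp only [h0]
    congr 1
    ext j
    simp only [Finset.mem_filter, Finset.mem_range, Finset.mem_Ico]
    omega
  rw [h1, ← Finset.mul_sum]
  calc 4 * ((n : ℝ) ^ (-a)) ^ 2 * ∑ j ∈ Finset.Ico i n, ((j : ℝ) + 1) ^ (-1 - (1 - 2 * a))
      ≤ 4 * ((n : ℝ) ^ (-a)) ^ 2 * ((i : ℝ) ^ (-(1 - 2 * a)) / (1 - 2 * a)) := by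
        gcongr
        refine (sum_Ico_rpow_le hη hi0 hi).trans ?_
        gcongr
        exact sub_le_self _ (by positivity)
    _ = _ := by
        have h2 : (i : ℝ) ^ (-(1 - 2 * a)) = ((i : ℝ) ^ a) ^ 2 / i := by
          rw [← Real.rpow_mul_natCast hi'.le, show -(1 - 2 * a) = a * (2 : ℕ) - 1 by
            push_cast; ring, Real.rpow_sub hi', Real.rpow_one]
        rw [h2, Real.div_rpow hi'.le hn'.le, Real.rpow_neg hn'.le]
        field_simp

open scoped Nat in
-- The first `i` variables are heavy, with mass of order `τ = (i / n) ^ a`. Taking `θ = τ` and `z =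
-- i / τ` makes all three terms of the exponent `O(i)`, leaving `τ ^ (k - b)` per clause.
theorem prob_fewUnique_le_pow {β : ℝ} (hβ : 1 < β) (ha : 0 < a) (ha2 : a < 1 / 2)
    (haβ : a ≤ (β - 2) / (β - 1)) {k m : ℕ} (hn : 2 * k ≤ n) (b : ℝ)
    {J : Finset (Fin m)} (hJ0 : 1 ≤ J.card) (hJn : J.card ≤ n) :
    prob β (fewUnique k n m b J) ≤
      ((k : ℝ) ^ k * Real.exp (4 / a + 4 / (1 - 2 * a)) *
        ((J.card : ℝ) / n) ^ (a * (k - b))) ^ J.card := by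
  set i := J.card with hi
  have hi' : (0 : ℝ) < i := by exact_mod_cast hJ0
  have hn' : (0 : ℝ) < n := by exact_mod_cast hJ0.trans hJn
  have hη : 0 < 1 - 2 * a := by linarith
  set τ : ℝ := ((i : ℝ) / n) ^ a with hτ
  have hτ0 : 0 < τ := by positivity
  have hτ1 : τ ≤ 1 := Real.rpow_le_one (by positivity)
    (by rw [div_le_one hn']; exact_mod_cast hJn) ha.le
  have h := prob_fewUnique_le (β := β) (domWeight_nonneg a)
    (varsMass_le_prod_domWeight hβ haβ hn) hτ0 hτ1
    (div_pos hi' hτ0) (Finset.univ.filter fun x : Fin n => (x : ℕ) < i) b J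
  rw [← hi] at h
  refine h.trans ?_
  have h1 : (i / τ) * ∑ x ∈ Finset.univ.filter fun x : Fin n => (x : ℕ) < i, domWeight a x ≤ i * (2 / a) := by
    calc _ ≤ (i / τ) * (2 / a * τ) := by
          gcongr
          exact sum_domWeight_lt_le ha (by linarith) hJn
      _ = _ := by field_simp
  have h2 : (i / τ) ^ 2 *
      ∑ x ∈ (Finset.univ.filter fun x : Fin n => (x : ℕ) < i)ᶜ, domWeight a x ^ 2 ≤
      i * (4 / (1 - 2 * a)) := by
    calc _ ≤ (i / τ) ^ 2 * (4 / (1 - 2 * a) * τ ^ 2 / i) := by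
          gcongr
          exact sum_domWeight_sq_ge_le ha2 hJ0 hJn
      _ = _ := by field_simp
  have h3 : τ * (i / τ) * ∑ x : Fin n, domWeight a x ≤ i * (2 / a) := by
    rw [mul_div_cancel₀ _ hτ0.ne']
    gcongr
    exact sum_domWeight_le ha (by linarith)
  have h4 : ((i * k)! : ℝ) / (i / τ) ^ (i * k) ≤ ((k : ℝ) * τ) ^ (i * k) := by
    rw [div_le_iff₀ (by positivity), ← mul_pow]
    have : (k : ℝ) * τ * (i / τ) = (i * k : ℕ) := by
      push_cast
      field_simp
    rw [this]
    exact_mod_cast Nat.factorial_le_pow (i * k)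
  calc _ ≤ τ ^ (-(b * i)) * (((k : ℝ) * τ) ^ (i * k) *
        Real.exp (i * (4 / a + 4 / (1 - 2 * a)))) := by
        gcongr
        have : (i : ℝ) * (4 / a + 4 / (1 - 2 * a)) =
          i * (2 / a) + i * (4 / (1 - 2 * a)) + i * (2 / a) := by ring
        linarith
    _ = _ := by
        have h5 : ((i : ℝ) / n) ^ (a * (k - b)) = τ ^ k * τ ^ (-b) := by
          rw [Real.rpow_mul (by positivity), ← hτ, ← Real.rpow_natCast, ← Real.rpow_add hτ0]
          rfl
        have h6 : τ ^ (-(b * i)) = (τ ^ (-b)) ^ i := by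
          rw [← Real.rpow_natCast, ← Real.rpow_mul hτ0.le]
          congr 1
          ring
        rw [h5, h6, Real.exp_nat_mul, mul_comm i k, pow_mul, mul_pow (k : ℝ) τ k]
        simp only [mul_pow]
        ring

end DominatingWeights

/-! ### Union bound over clause sets and conditioning -/

section FirstMoment

variable {a β : ℝ} {k n m : ℕ}

theorem choose_le_exp_mul_div_pow (m : ℕ) {i : ℕ} (hi : 1 ≤ i) :
    (m.choose i : ℝ) ≤ (Real.exp 1 * (m / i)) ^ i := by
  have hi' : (0 : ℝ) < i := by exact_mod_cast hi
  have h1 := Nat.choose_le_pow_div (α := ℝ) i m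
  have h2 := Real.pow_div_factorial_le_exp (i : ℝ) hi'.le i
  refine h1.trans ?_
  have h3 : (Real.exp 1 * (m / i)) ^ i = Real.exp i * (m : ℝ) ^ i / (i : ℝ) ^ i := by
    rw [mul_pow, div_pow, ← Real.exp_nat_mul, mul_one]
    ring
  rw [h3, le_div_iff₀ (by positivity)]
  calc (m : ℝ) ^ i / i.factorial * (i : ℝ) ^ i = ((i : ℝ) ^ i / i.factorial) * (m : ℝ) ^ i := by
        ring
    _ ≤ _ := by gcongr

/-- The constant of the first-moment bound. -/
noncomputable def expansionConst (k : ℕ) (a : ℝ) : ℝ :=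
  Real.exp 1 * ((k : ℝ) ^ k * Real.exp (4 / a + 4 / (1 - 2 * a)))

theorem expansionConst_pos (hk : 0 < k) : 0 < expansionConst k a := by
  unfold expansionConst
  positivity

theorem prob_compl_widthAtLeast_le (hβ : 1 < β) (ha : 0 < a) (ha2 : a < 1 / 2)
    (haβ : a ≤ (β - 2) / (β - 1)) (hn : 2 * k ≤ n) {b : ℝ} (hb : 0 < b) {r : ℕ} (hr : 1 ≤ r)
    (hrn : r ≤ n) {x : ℝ} (hx : x ≤ b * r / 2) :
    prob β (widthAtLeast k n m x)ᶜ ≤ ∑ i ∈ Finset.Icc 1 r,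
      (expansionConst k a * (m / n) * ((i : ℝ) / n) ^ (a * (k - b) - 1)) ^ i := by
  classical
  have h1 : prob β (widthAtLeast k n m x)ᶜ ≤
      ∑ J ∈ (Finset.Icc 1 r).biUnion fun i =>
        (Finset.univ : Finset (Fin m)).powersetCard i, prob β (fewUnique k n m b J) := by
    refine prob_le_sum_of_subset _ _ _ fun Φ hΦ => ?_
    by_contra hcon
    push Not at hcon
    refine hΦ (ceil_le_resolutionWidth (cl := Φ.clause) hr hb (fun J hJ hJr => ?_) hx)
    have h2 := hcon J (by simpa using ⟨hJ, hJr⟩)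
    rw [fewUnique, Set.mem_ofPred_eq, not_lt] at h2
    exact h2.trans (by exact_mod_cast Finset.card_le_card (unique_subset_boundary Φ J))
  refine h1.trans ?_
  rw [Finset.sum_biUnion]
  · refine Finset.sum_le_sum fun i hi => ?_
    obtain ⟨hi1, hir⟩ := Finset.mem_Icc.1 hi
    have hi' : (0 : ℝ) < i := by exact_mod_cast hi1
    have hn' : (0 : ℝ) < n := by exact_mod_cast hi1.trans (hir.trans hrn)
    have h3 : ∀ J ∈ (Finset.univ : Finset (Fin m)).powersetCard i,
        prob β (fewUnique k n m b J) ≤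
        ((k : ℝ) ^ k * Real.exp (4 / a + 4 / (1 - 2 * a)) * ((i : ℝ) / n) ^ (a * (k - b))) ^ i := by
      intro J hJ
      obtain ⟨-, rfl⟩ := Finset.mem_powersetCard.1 hJ
      exact prob_fewUnique_le_pow hβ ha ha2 haβ hn b hi1 (hir.trans hrn)
    refine (Finset.sum_le_card_nsmul _ _ _ h3).trans ?_
    rw [Finset.card_powersetCard, Finset.card_univ, Fintype.card_fin, nsmul_eq_mul]
    refine (mul_le_mul_of_nonneg_right (choose_le_exp_mul_div_pow m hi1)
      (by positivity)).trans (le_of_eq ?_)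
    rw [← mul_pow, Real.rpow_sub (by positivity), Real.rpow_one, expansionConst]
    congr 1
    field_simp
  · intro i _ j _ hij
    exact Finset.pairwise_disjoint_powersetCard _ hij

/-- One factor of each power is kept to supply `T`; the others are at most `1/2`. The bound is
linear in `T` uniformly in `r`, so it vanishes with `T`. -/
theorem sum_pow_le_of_le_half {e T : ℝ} (he : 0 < e) (hT : 0 ≤ T) {r : ℕ}
    (hr : T * (r : ℝ) ^ e ≤ 1 / 2) :
    ∑ i ∈ Finset.Icc 1 r, (T * (i : ℝ) ^ e) ^ i ≤
      2 * T * ∑' i : ℕ, (i : ℝ) ^ ⌈e⌉₊ * (1 / 2 : ℝ) ^ i := by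
  have hs : Summable fun i : ℕ => (i : ℝ) ^ ⌈e⌉₊ * (1 / 2 : ℝ) ^ i :=
    summable_pow_mul_geometric_of_norm_lt_one _ (by norm_num)
  refine le_trans ?_ (mul_le_mul_of_nonneg_left
    (hs.sum_le_tsum (Finset.Icc 1 r) fun i _ => by positivity) (by positivity))
  rw [Finset.mul_sum]
  refine Finset.sum_le_sum fun i hi => ?_
  obtain ⟨hi1, hir⟩ := Finset.mem_Icc.1 hi
  have h1 : T * (i : ℝ) ^ e ≤ 1 / 2 := by
    refine le_trans ?_ hr
    gcongr
  have h2 : (i : ℝ) ^ e ≤ (i : ℝ) ^ ⌈e⌉₊ := by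
    rw [← Real.rpow_natCast]
    exact Real.rpow_le_rpow_of_exponent_le (by exact_mod_cast hi1) (Nat.le_ceil e)
  obtain ⟨l, rfl⟩ := Nat.exists_eq_add_of_le hi1
  calc (T * ((1 + l : ℕ) : ℝ) ^ e) ^ (1 + l)
      = (T * ((1 + l : ℕ) : ℝ) ^ e) * (T * ((1 + l : ℕ) : ℝ) ^ e) ^ l := by rw [pow_add, pow_one]
    _ ≤ (T * ((1 + l : ℕ) : ℝ) ^ ⌈e⌉₊) * (1 / 2) ^ l := by gcongr
    _ = _ := by
        rw [pow_add]
        ring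

theorem tendsto_prob_compl_widthAtLeast (hk : 0 < k) (hβ : 1 < β) (ha : 0 < a) (ha2 : a < 1 / 2)
    (haβ : a ≤ (β - 2) / (β - 1)) {b e δ : ℝ} (hb : 0 < b) (he : e = a * (k - b) - 1)
    (he0 : 0 < e) (hδ : 0 < δ) :
    ∃ c : ℝ, 0 < c ∧ ∀ (m : ℕ → ℕ) (Δ : ℕ → ℝ),
      (∀ n, Δ n = (m n : ℝ) / (n : ℝ)) →
      (∀ᶠ n : ℕ in atTop, δ * (n : ℝ) ≤ (m n : ℝ)) →
      Δ =o[atTop] (fun n : ℕ => (n : ℝ) ^ e) →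
      Tendsto (fun n : ℕ => prob β
        (widthAtLeast k n (m n) (c * ((n : ℝ) * Δ n ^ (-1 / e))))ᶜ) atTop (𝓝 0) := by
  set K := expansionConst k a with hK
  have hK0 : 0 < K := expansionConst_pos hk
  -- The first entry makes the base of each power at most `1/2` up to `r`; the second, with `δ ≤ Δ
  -- n`, ensures `r ≤ n`.
  set c₀ : ℝ := min ((2 * K) ^ (-1 / e)) (δ ^ (1 / e)) with hc₀
  have hc₀_pos : 0 < c₀ := by positivity
  have hc₀K : K * c₀ ^ e ≤ 1 / 2 := by
    have : c₀ ^ e ≤ (2 * K)⁻¹ := by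
      calc c₀ ^ e ≤ ((2 * K) ^ (-1 / e)) ^ e := by
            gcongr
            exact min_le_left _ _
        _ = (2 * K)⁻¹ := by
            rw [← Real.rpow_mul (by positivity), div_mul_cancel₀ _ he0.ne', Real.rpow_neg_one]
    calc K * c₀ ^ e ≤ K * (2 * K)⁻¹ := by gcongr
      _ = 1 / 2 := by field_simp
  -- Of the factor `4`, one `2` comes from `b * r / 2` and one from rounding `y` down to `r`.
  refine ⟨b * c₀ / 4, by positivity, fun m Δ hΔ hm hΔo => ?_⟩
  have hlim : Tendsto (fun n : ℕ => Δ n / (n : ℝ) ^ e) atTop (𝓝 0) :=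
    hΔo.tendsto_div_nhds_zero
  have hlim2 := hlim.const_mul (2 * K * ∑' i : ℕ, (i : ℝ) ^ ⌈e⌉₊ * (1 / 2 : ℝ) ^ i)
  rw [mul_zero] at hlim2
  refine squeeze_zero' (Eventually.of_forall fun n => prob_nonneg _) ?_ hlim2
  filter_upwards [hm, eventually_ge_atTop (2 * k), eventually_gt_atTop 0,
    hlim.eventually (gt_mem_nhds (Real.rpow_pos_of_pos hc₀_pos e))] with n hmn hnk hn0 hsmall
  have hn' : (0 : ℝ) < n := by exact_mod_cast hn0
  have hδΔ : δ ≤ Δ n := by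
    rw [hΔ, le_div_iff₀ hn']
    exact hmn
  have hΔ0 : 0 < Δ n := hδ.trans_le hδΔ
  set y : ℝ := c₀ * (n * Δ n ^ (-1 / e)) with hy
  have hΔinv : (Δ n ^ (-1 / e)) ^ e = (Δ n)⁻¹ := by
    rw [← Real.rpow_mul hΔ0.le, div_mul_cancel₀ _ he0.ne', Real.rpow_neg_one]
  have hy0 : 0 ≤ y := by positivity
  have hye : y ^ e = c₀ ^ e * n ^ e / Δ n := by
    rw [hy, Real.mul_rpow hc₀_pos.le (by positivity), Real.mul_rpow hn'.le (by positivity), hΔinv]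
    ring
  have hy1 : 1 ≤ y := by
    rw [div_lt_iff₀ (by positivity)] at hsmall
    have : (1 : ℝ) ^ e ≤ y ^ e := by
      rw [hye, Real.one_rpow, le_div_iff₀ hΔ0, one_mul]
      exact hsmall.le
    exact (Real.rpow_le_rpow_iff zero_le_one hy0 he0).1 this
  have hyn : y ≤ n := by
    have h1 : c₀ * Δ n ^ (-1 / e) ≤ 1 := by
      calc c₀ * Δ n ^ (-1 / e) ≤ δ ^ (1 / e) * δ ^ (-1 / e) := by
            refine mul_le_mul (min_le_right _ _) ?_ (by positivity) (by positivity)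
            refine Real.rpow_le_rpow_of_nonpos hδ hδΔ ?_
            exact div_nonpos_of_nonpos_of_nonneg (by norm_num) he0.le
        _ = 1 := by
            rw [← Real.rpow_add hδ, ← add_div]
            norm_num
    calc y = n * (c₀ * Δ n ^ (-1 / e)) := by
          rw [hy]
          ring
      _ ≤ n * 1 := by gcongr
      _ = n := mul_one _
  set r := ⌊y⌋₊ with hr
  have hr1 : 1 ≤ r := Nat.le_floor (by exact_mod_cast hy1)
  have hry : (r : ℝ) ≤ y := Nat.floor_le hy0
  have hrn : r ≤ n := by exact_mod_cast hry.trans hyn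
  have hx : b * c₀ / 4 * (n * Δ n ^ (-1 / e)) ≤ b * r / 2 := by
    have h1 : y < r + 1 := Nat.lt_floor_add_one y
    have h2 : (1 : ℝ) ≤ r := by exact_mod_cast hr1
    have h3 : b * c₀ / 4 * (n * Δ n ^ (-1 / e)) = b * (y / 4) := by
      rw [hy]
      ring
    have h4 : b * (y / 4) ≤ b * (r / 2) := mul_le_mul_of_nonneg_left (by linarith) hb.le
    linarith
  refine (prob_compl_widthAtLeast_le hβ ha ha2 haβ hnk hb hr1 hrn hx).trans ?_
  have h4 : ∀ i ∈ Finset.Icc 1 r,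
      (expansionConst k a * (m n / n) * ((i : ℝ) / n) ^ (a * (k - b) - 1)) ^ i =
      (K * (Δ n / n ^ e) * (i : ℝ) ^ e) ^ i := by
    intro i _
    rw [← he, Real.div_rpow (by positivity) hn'.le, ← hΔ, ← hK]
    congr 1
    ring
  rw [Finset.sum_congr rfl h4]
  refine (sum_pow_le_of_le_half he0 (by positivity) ?_).trans (le_of_eq (by ring))
  calc K * (Δ n / n ^ e) * (r : ℝ) ^ e ≤ K * (Δ n / n ^ e) * y ^ e := by gcongr
    _ = K * c₀ ^ e := by
        rw [hye]
        field_simp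
    _ ≤ 1 / 2 := hc₀K

theorem widthAtLeast_anti {x y : ℝ} (h : x ≤ y) : widthAtLeast k n m y ⊆ widthAtLeast k n m x :=
  fun Φ (hΦ : (⌈y⌉₊ : ℕ∞) ≤ _) =>
    show (⌈x⌉₊ : ℕ∞) ≤ _ from le_trans (by exact_mod_cast Nat.ceil_mono h) hΦ

theorem tendsto_condProb_one {m : ℕ → ℕ} {A B : ∀ n, Set (Sample k n (m n))}
    (hA : Tendsto (fun n => prob β (A n)ᶜ) atTop (𝓝 0)) {p : ℝ} (hp : 0 < p)
    (hB : ∀ᶠ n in atTop, p ≤ prob β (B n)) :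
    Tendsto (fun n => condProb β (A n) (B n)) atTop (𝓝 1) := by
  have h1 : Tendsto (fun n => prob β (B n \ A n) / prob β (B n)) atTop (𝓝 0) := by
    have h2 := hA.div_const p
    rw [zero_div] at h2
    refine squeeze_zero' (Eventually.of_forall fun n =>
      div_nonneg (prob_nonneg _) (prob_nonneg _)) ?_ h2
    filter_upwards [hB] with n hn
    exact div_le_div₀ (prob_nonneg _) (prob_mono fun _ h => h.2) hp hn
  have h3 := h1.const_sub 1
  rw [sub_zero] at h3
  refine h3.congr' ?_
  filter_upwards [hB] with n hn
  have h4 : prob β (B n) ≠ 0 := (hp.trans_le hn).ne'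
  rw [condProb, eq_div_iff h4, sub_mul, div_mul_cancel₀ _ h4, one_mul,
    ← prob_inter_add_diff (A n) (B n)]
  ring

/-- Conditioned on unsatisfiability, the resolution width is asymptotically almost surely at least
`c n Δ ^ (-1 / e)`, for all clause densities `Δ ≥ δ` in `o(n ^ e)`. -/
def WidthBound (k : ℕ) (β δ e c : ℝ) : Prop :=
  ∀ (m : ℕ → ℕ) (Δ : ℕ → ℝ),
    (∀ n, Δ n = (m n : ℝ) / (n : ℝ)) →
    (∀ᶠ n : ℕ in atTop, δ * (n : ℝ) ≤ (m n : ℝ)) →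
    (∃ p : ℝ, 0 < p ∧ ∀ᶠ n : ℕ in atTop, p ≤ prob β (unsat k n (m n))) →
    Δ =o[atTop] (fun n : ℕ => (n : ℝ) ^ e) →
    ∀ x : ℕ → ℝ, (∀ᶠ n : ℕ in atTop, x n ≤ c * ((n : ℝ) * Δ n ^ (-1 / e))) →
    Tendsto (fun n : ℕ => condProb β (widthAtLeast k n (m n) (x n)) (unsat k n (m n)))
      atTop (𝓝 1)

theorem exists_widthBound (hk : 0 < k) (hβ : 1 < β) (ha : 0 < a) (ha2 : a < 1 / 2)
    (haβ : a ≤ (β - 2) / (β - 1)) {b e δ : ℝ} (hb : 0 < b) (he : e = a * (k - b) - 1)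
    (he0 : 0 < e) (hδ : 0 < δ) : ∃ c : ℝ, 0 < c ∧ WidthBound k β δ e c := by
  obtain ⟨c, hc, h⟩ := tendsto_prob_compl_widthAtLeast hk hβ ha ha2 haβ hb he he0 hδ
  refine ⟨c, hc, fun m Δ hΔ hm ⟨p, hp, hpB⟩ hΔo x hx => tendsto_condProb_one ?_ hp hpB⟩
  refine squeeze_zero' (Eventually.of_forall fun n => prob_nonneg _) ?_ (h m Δ hΔ hm hΔo)
  filter_upwards [hx] with n hn
  exact prob_mono (Set.compl_subset_compl.2 (widthAtLeast_anti hn))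

end FirstMoment

end PowerLawSAT

/-! ### Choice of parameters in the four regimes -/

theorem mainTheorem1
    (k : ℕ) (hk : 3 ≤ k)
    (β : ℝ) (hβ : (2 * (k : ℝ) - 1) / ((k : ℝ) - 1) < β)
    (ε ε₁ ε₂ ε₃ : ℝ) (hε : 0 < ε)
    (hε₁ : ε₁ = ((k : ℝ) - ε) / 2 - 1) (hε₁_pos : 0 < ε₁)
    (hε₂ : ε₂ = ((k : ℝ) - ε) * ((β - 2) / (β - 1)) - 1) (hε₂_pos : 0 < ε₂)
    (δ : ℝ) (hδ : 0 < δ) :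
    ∃ c : ℝ, 0 < c ∧ ∀ (m : ℕ → ℕ) (Δ : ℕ → ℝ),
      (∀ n, Δ n = (m n : ℝ) / (n : ℝ)) →
      (∀ᶠ n : ℕ in atTop, δ * (n : ℝ) ≤ (m n : ℝ)) →
      (∃ p : ℝ, 0 < p ∧ ∀ᶠ n : ℕ in atTop, p ≤ prob β (unsat k n (m n))) →
      ((β < 3 →
          Δ =o[atTop] (fun n : ℕ => (n : ℝ) ^ ε₂) →
          Tendsto (fun n : ℕ => condProb β
              (widthAtLeast k n (m n) (c * ((n : ℝ) ^ (ε₂ / ε₁) * Δ n ^ (-1 / ε₁))))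
              (unsat k n (m n)))
            atTop (𝓝 1)) ∧
       (β = 3 →
          Δ =o[atTop] (fun n : ℕ => (n : ℝ) ^ ε₁ / Real.log n ^ (1 + ε₁)) →
          Tendsto (fun n : ℕ => condProb β
              (widthAtLeast k n (m n)
                (c * ((n : ℝ) * Δ n ^ (-1 / ε₁) / Real.log n ^ (1 + 1 / ε₁))))
              (unsat k n (m n)))
            atTop (𝓝 1)) ∧
       (3 < β →
          Δ =o[atTop] (fun n : ℕ => (n : ℝ) ^ ε₁) →
          Tendsto (fun n : ℕ => condProb β
              (widthAtLeast k n (m n) (c * ((n : ℝ) * Δ n ^ (-1 / ε₁))))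
              (unsat k n (m n)))
            atTop (𝓝 1)) ∧
       ((2 * (k : ℝ) - 2) / ((k : ℝ) - 2) < β →
          0 < ε₃ → ε₃ < (k : ℝ) / 2 * ((β - 2) / (β - 1)) - 1 →
          Δ =o[atTop] (fun n : ℕ => (n : ℝ) ^ ε₃ / Real.log n ^ ε₃) →
          Tendsto (fun n : ℕ => condProb β
              (widthAtLeast k n (m n) (c * ((n : ℝ) * Δ n ^ (-1 / ε₃))))
              (unsat k n (m n)))
            atTop (𝓝 1))) := by
  have hk0 : 0 < k := by omega
  have hk3 : (3 : ℝ) ≤ k := by exact_mod_cast hk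
  have hβ2 : 2 < β := by
    refine lt_of_le_of_lt ?_ hβ
    rw [le_div_iff₀ (by linarith)]
    linarith
  have hβ1 : 0 < β - 1 := by linarith
  set α : ℝ := (β - 2) / (β - 1) with hα
  have hα0 : 0 < α := div_pos (by linarith) hβ1
  have hα1 : α < 1 := by
    rw [hα, div_lt_one hβ1]
    linarith
  have hkε : 2 < (k : ℝ) - ε := by linarith
  have low : ∃ c : ℝ, 0 < c ∧ (β < 3 → WidthBound k β δ ε₂ c) := by
    by_cases h : β < 3
    · have hα2 : α < 1 / 2 := by
        rw [hα, div_lt_iff₀ hβ1]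
        linarith
      obtain ⟨c, hc, H⟩ := exists_widthBound hk0 (by linarith : 1 < β) hα0 hα2
        le_rfl hε (by rw [hε₂]; ring) hε₂_pos hδ
      exact ⟨c, hc, fun _ => H⟩
    · exact ⟨1, one_pos, fun h' => absurd h' h⟩
  have high : ∃ c : ℝ, 0 < c ∧ (3 ≤ β → WidthBound k β δ ε₁ c) := by
    by_cases h : 3 ≤ β
    · have hα2 : 1 / 2 ≤ α := by
        rw [hα, le_div_iff₀ hβ1]
        linarith
      have hkε' : 0 < (k : ℝ) - ε / 2 := by linarith
      -- With `b = ε / 2`, this `a` solves `a * (k - b) - 1 = ε₁`. Spending only half of `ε` on `b`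
      -- keeps `a` strictly below `1/2`, so `β = 3` needs no logarithms.
      have ha2 : ((k : ℝ) - ε) / (2 * (k - ε / 2)) < 1 / 2 := by
        rw [div_lt_iff₀ (by linarith)]
        linarith
      have heq : ε₁ = ((k : ℝ) - ε) / (2 * (k - ε / 2)) * (k - ε / 2) - 1 := by
        rw [hε₁, ← div_div, div_mul_cancel₀ _ hkε'.ne']
      obtain ⟨c, hc, H⟩ := exists_widthBound hk0 (by linarith : 1 < β)
        (div_pos (by linarith) (by linarith)) ha2 (ha2.le.trans hα2) (half_pos hε)
        heq hε₁_pos hδ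
      exact ⟨c, hc, fun _ => H⟩
    · exact ⟨1, one_pos, fun h' => absurd h' h⟩
  have linear : ∃ c : ℝ, 0 < c ∧ (0 < ε₃ → ε₃ < (k : ℝ) / 2 * α - 1 → WidthBound k β δ ε₃ c) := by
    by_cases h : 0 < ε₃ ∧ ε₃ < (k : ℝ) / 2 * α - 1
    -- Now `a = α / 2`, and `b` is solved from `a * (k - b) - 1 = ε₃`; the upper bound on `ε₃` makes
    -- it positive.
    · have hb : 0 < (k : ℝ) - 2 * (1 + ε₃) / α := by
        rw [sub_pos, div_lt_iff₀ hα0]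
        linarith [h.2]
      obtain ⟨c, hc, H⟩ := exists_widthBound (k := k) (β := β) (a := α / 2) hk0
        (by linarith) (by linarith) (by linarith) (by linarith) hb
        (e := ε₃) (by field_simp; ring) h.1 hδ
      exact ⟨c, hc, fun _ _ => H⟩
    · exact ⟨1, one_pos, fun h1 h2 => absurd ⟨h1, h2⟩ h⟩
  obtain ⟨c₁, hc₁, H₁⟩ := low
  obtain ⟨c₂, hc₂, H₂⟩ := high
  obtain ⟨c₃, hc₃, H₃⟩ := linear
  refine ⟨min c₁ (min c₂ c₃), by positivity, fun m Δ hΔ hm hp => ?_⟩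
  have hmin₁ : min c₁ (min c₂ c₃) ≤ c₁ := min_le_left _ _
  have hmin₂ : min c₁ (min c₂ c₃) ≤ c₂ := (min_le_right _ _).trans (min_le_left _ _)
  have hmin₃ : min c₁ (min c₂ c₃) ≤ c₃ := (min_le_right _ _).trans (min_le_right _ _)
  have hΔ0 : ∀ n, 0 ≤ Δ n := fun n => by
    rw [hΔ]
    positivity
  have hlog : ∀ᶠ n : ℕ in atTop, 1 ≤ Real.log n :=
    (Real.tendsto_log_atTop.comp tendsto_natCast_atTop_atTop).eventually_ge_atTop 1
  have hdrop : ∀ s t : ℝ, 0 ≤ t → Δ =o[atTop] (fun n : ℕ => (n : ℝ) ^ s / Real.log n ^ t) →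
      Δ =o[atTop] (fun n : ℕ => (n : ℝ) ^ s) := by
    intro s t ht h
    refine h.trans_isBigO (IsBigO.of_bound 1 ?_)
    filter_upwards [hlog] with n hn
    have h1 : 1 ≤ Real.log n ^ t := Real.one_le_rpow hn ht
    have h2 : 0 ≤ (n : ℝ) ^ s := by positivity
    rw [one_mul, Real.norm_of_nonneg (by positivity), Real.norm_of_nonneg h2]
    exact div_le_self h2 h1
  refine ⟨fun hβ3 ho => ?_, fun hβ3 ho => ?_, fun hβ3 ho => ?_, fun _ h0 h1 ho => ?_⟩
  · refine H₁ hβ3 m Δ hΔ hm hp ho _ ?_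
    -- The proved bound is `(n ^ ε₂ / Δ) ^ (1 / ε₂)` and the required one has exponent `1 / ε₁`. The
    -- base is eventually at least one, so `ε₂ ≤ ε₁` suffices.
    have hε₂₁ : ε₂ ≤ ε₁ := by
      have : α ≤ 1 / 2 := by
        rw [hα, div_le_iff₀ hβ1]
        linarith
      rw [hε₁, hε₂]
      nlinarith
    filter_upwards [hm, eventually_gt_atTop 0, ho.bound one_pos] with n hmn hn0 hle
    have hn' : (0 : ℝ) < n := by exact_mod_cast hn0
    have hΔpos : 0 < Δ n := by
      rw [hΔ]
      exact div_pos ((mul_pos hδ hn').trans_le hmn) hn'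
    rw [one_mul, Real.norm_of_nonneg hΔpos.le, Real.norm_of_nonneg (by positivity)] at hle
    have hratio : 1 ≤ (n : ℝ) ^ ε₂ / Δ n := by rwa [one_le_div hΔpos]
    have hpow : ∀ s : ℝ, (n : ℝ) ^ (ε₂ / s) * Δ n ^ (-1 / s) = ((n : ℝ) ^ ε₂ / Δ n) ^ (1 / s) := by
      intro s
      rw [Real.div_rpow (by positivity) hΔpos.le, ← Real.rpow_mul hn'.le, neg_div,
        Real.rpow_neg hΔpos.le, mul_one_div]
      rfl
    have hfirst := hpow ε₂
    rw [div_self hε₂_pos.ne', Real.rpow_one] at hfirst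
    rw [hpow ε₁, hfirst]
    gcongr
  · refine H₂ hβ3.ge m Δ hΔ hm hp (hdrop _ _ (by linarith) ho) _ ?_
    filter_upwards [hlog] with n hn
    have h1 : 1 ≤ Real.log n ^ (1 + 1 / ε₁) := Real.one_le_rpow hn (by positivity)
    have h2 : 0 ≤ (n : ℝ) * Δ n ^ (-1 / ε₁) :=
      mul_nonneg (Nat.cast_nonneg n) (Real.rpow_nonneg (hΔ0 n) _)
    exact mul_le_mul hmin₂ (div_le_self h2 h1) (by positivity) hc₂.le
  · refine H₂ hβ3.le m Δ hΔ hm hp ho _ (Eventually.of_forall fun n => ?_)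
    exact mul_le_mul_of_nonneg_right hmin₂
      (mul_nonneg (Nat.cast_nonneg n) (Real.rpow_nonneg (hΔ0 n) _))
  · refine H₃ h0 h1 m Δ hΔ hm hp (hdrop _ _ h0.le ho) _ (Eventually.of_forall fun n => ?_)
    exact mul_le_mul_of_nonneg_right hmin₃
      (mul_nonneg (Nat.cast_nonneg n) (Real.rpow_nonneg (hΔ0 n) _))
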